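/- Let $\mathfrak u$ be a compact simple real Lie algebra, $\theta$ an involutive automorphism of $\mathfrak u$ with $\theta\neq\mathrm{id}$, $\mathfrak u=\mathfrak k_0\oplus\mathfrak p_*$ the decomposition into the $+1$ and $-1$ eigenspaces of $\theta$, and $\langle\,,\rangle$ an $\operatorname{ad}\mathfrak k_0$-invariant inner product on $\mathfrak p_*$; that is, $(\mathfrak u,\theta,\langle\,,\rangle)$ is a reduced, irreducible, compact orthogonal involutive Lie algebra of type I. Let $\mathfrak g=\mathfrak u\otimes_{\mathbb R}\mathbb C$, extend $\theta$ complex linearly to $\mathfrak g$, and let $(\,,)$ be the Killing form of $\mathfrak g$. Let $\mathfrak h_{\mathfrak p_*}$ be a maximal abelian subspace of $\mathfrak p_*$ and $\mathfrak h_{\mathfrak k_0}$ an abelian subalgebra of $\mathfrak k_0$ such that $\mathfrak h_{\mathfrak k_0}\oplus\mathfrak h_{\mathfrak p_*}$ is a maximal abelian subalgebra of $\mathfrak u$. Put $\mathfrak h=(\mathfrak h_{\mathfrak k_0}\oplus\mathfrak h_{\mathfrak p_*})\otimes\mathbb C$, $\mathfrak h_{\mathfrak p}=\mathfrak h_{\mathfrak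 p_*}\otimes\mathbb C$, $\mathfrak h_{\mathbb R}=\sqrt{-1}\,(\mathfrak h_{\mathfrak k_0}\oplus\mathfrak h_{\mathfrak p_*})$ and $\mathfrak h_{\mathfrak p_0}=\sqrt{-1}\,\mathfrak h_{\mathfrak p_*}$. Let $\Delta\subset\mathfrak h_{\mathbb R}$ be the root system of $\mathfrak g$ with respect to $\mathfrak h$, roots being identified with vectors through the Killing form. For $\alpha\in\Delta$ write $\alpha^\theta=\theta(\alpha)$ and $\bar\alpha=\tfrac12(\alpha-\alpha^\theta)$, and put $\Delta_0=\{\alpha\in\Delta:\bar\alpha=0\}$. For $\gamma\in\mathfrak h_{\mathfrak p_0}$ let $m_\gamma=\dim_{\mathbb C}\{x\in\mathfrak g:[H,x]=(H,\gamma)x\ \text{for all } H\in\mathfrak h_{\mathfrak p}\}$ be its multiplicity. Fix lexicographic orderings of $\mathfrak h_{\mathbb R}$ and $\mathfrak h_{\mathfrak p_0}$ that are compatible, i.e. $\alpha\ge\beta$ implies $\bar\alpha\ge\bar\beta$ for all $\alpha,\beta\in\Delta$. Let $\Pi$ be the set of simple roots and $\delta$ the highest root of $\Delta$ for this ordering,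 and put $\Pi_0=\Pi\cap\Delta_0$ and $\delta^\perp=\{x\in\mathfrak h_{\mathbb R}:(x,\delta)=0\}$. Then $(\bar\delta,\bar\delta)=(\delta,\delta)$ or $(\bar\delta,\bar\delta)=\tfrac12(\delta,\delta)$, and the following conditions are equivalent: (a) $(\bar\delta,\bar\delta)=(\delta,\delta)$; (b) $\delta^\theta=-\delta$; (c) $\Pi_0\subset\Pi\cap\delta^\perp$; (d) $m_{\bar\delta}=1$. -/

import Mathlib

open scoped TensorProduct

namespace SymmetricLie

section RealForm

variable {u : Type*} [LieRing u] [LieAlgebra ℝ u]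

/-- A compact semisimple real Lie algebra: its Killing form is negative definite. -/
def IsCompact (u : Type*) [LieRing u] [LieAlgebra ℝ u] : Prop :=
  ∀ x : u, x ≠ 0 → killingForm ℝ u x x < 0

/-- `𝔨₀ = {X ∈ 𝔲 : θ X = X}`. -/
def kZero (θ : u ≃ₗ⁅ℝ⁆ u) : Submodule ℝ u where
  carrier := {x | θ x = x}
  add_mem' := by
    intro a b ha hb
    simp only [Set.mem_ofPred_eq] at ha hb ⊢
    rw [map_add, ha, hb]
  zero_mem' := map_zero θ
  smul_mem' := by
    intro c a ha
    simp only [Set.mem_ofPred_eq] at ha ⊢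
    rw [map_smul, ha]

/-- `𝔭_* = {X ∈ 𝔲 : θ X = -X}`. -/
def pStar (θ : u ≃ₗ⁅ℝ⁆ u) : Submodule ℝ u where
  carrier := {x | θ x = -x}
  add_mem' := by
    intro a b ha hb
    simp only [Set.mem_ofPred_eq] at ha hb ⊢
    rw [map_add, ha, hb, neg_add]
  zero_mem' := by simp
  smul_mem' := by
    intro c a ha
    simp only [Set.mem_ofPred_eq] at ha ⊢
    rw [map_smul, ha, smul_neg]

theorem lie_mem_pStar (θ : u ≃ₗ⁅ℝ⁆ u) {k x : u} (hk : k ∈ kZero θ) (hx : x ∈ pStar θ) :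
    ⁅k, x⁆ ∈ pStar θ := by
  change θ k = k at hk
  change θ x = -x at hx
  change θ ⁅k, x⁆ = -⁅k, x⁆
  rw [LieEquiv.map_lie, hk, hx, lie_neg]

/-- The data `(θ, ⟨,⟩)` turning the Lie algebra `𝔲` into an orthogonal involutive Lie algebra:
an automorphism of order two and an inner product on `𝔭_*` that is invariant under `ad 𝔨₀`.
(When `𝔲` is simple, `θ ≠ id` says exactly that the orthogonal involutive Lie algebra is reduced,
i.e. that `𝔨₀` contains no non-zero ideal of `𝔲`.) -/
structure OrthogonalInvolution (u : Type*) [LieRing u] [LieAlgebra ℝ u] where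
  θ : u ≃ₗ⁅ℝ⁆ u
  involutive : ∀ x, θ (θ x) = x
  ne_id : ∃ x, θ x ≠ x
  metric : LinearMap.BilinForm ℝ (pStar θ)
  metric_symm : ∀ x y, metric x y = metric y x
  metric_pos : ∀ x, x ≠ 0 → 0 < metric x x
  metric_invariant : ∀ (k : u) (hk : k ∈ kZero θ) (x y : pStar θ),
    metric ⟨⁅k, (x : u)⁆, lie_mem_pStar θ hk x.2⟩ y +
      metric x ⟨⁅k, (y : u)⁆, lie_mem_pStar θ hk y.2⟩ = 0

/-- A subspace on which the bracket vanishes (such a subspace is an abelian subalgebra). -/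
def IsAbelianSubspace (W : Submodule ℝ u) : Prop :=
  ∀ x ∈ W, ∀ y ∈ W, ⁅x, y⁆ = 0

/-- `hp` is a maximal abelian subspace of `𝔭_*`, and `hk` is an (abelian) subalgebra of `𝔨₀` such
that `hk ⊕ hp` is a maximal abelian subalgebra of `𝔲`. -/
structure IsCartanPair (θ : u ≃ₗ⁅ℝ⁆ u) (hk hp : Submodule ℝ u) : Prop where
  hp_maximal : Maximal (fun W : Submodule ℝ u => W ≤ pStar θ ∧ IsAbelianSubspace W) hp
  hk_le : hk ≤ kZero θ
  sup_maximal : Maximal (fun W : Submodule ℝ u => IsAbelianSubspace W) (hk ⊔ hp)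

end RealForm

section Complexification

variable {u : Type*} [LieRing u] [LieAlgebra ℝ u]

/-- `𝔤`, the complexification of `𝔲`. -/
abbrev Complexified (u : Type*) [LieRing u] [LieAlgebra ℝ u] : Type _ := ℂ ⊗[ℝ] u

/-- The complex linear extension of `θ` to `𝔤`. -/
noncomputable def thetaC (θ : u ≃ₗ⁅ℝ⁆ u) : Complexified u →ₗ[ℂ] Complexified u :=
  (θ : u →ₗ[ℝ] u).baseChange ℂ

/-- The bilinear form `(,)`: the Killing form, extended complex bilinearly (this extension is the
Killing form of `𝔤`). -/
noncomputable abbrev form (x y : Complexified u) : ℂ := killingForm ℂ (Complexified u) x y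

/-- `√-1 W ⊆ 𝔤` for a real subspace `W ⊆ 𝔲`. In particular `imag hp` is `𝔥_{𝔭₀}` and
`imag (hk ⊔ hp)` is `𝔥_ℝ`. -/
noncomputable def imag (W : Submodule ℝ u) : Submodule ℝ (Complexified u) :=
  W.map (TensorProduct.mk ℝ ℂ u Complex.I)

/-- The root system `Δ` of `𝔤` with respect to `𝔥 = W ⊗ ℂ`, where roots are identified with
vectors of `𝔥` through the Killing form. -/
def roots (W : Submodule ℝ u) : Set (Complexified u) :=
  {α | α ∈ W.baseChange ℂ ∧ α ≠ 0 ∧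
    ∃ x : Complexified u, x ≠ 0 ∧ ∀ H ∈ W.baseChange ℂ, ⁅H, x⁆ = form H α • x}

/-- `ᾱ = (α - α^θ)/2`. -/
noncomputable def bar (θ : u ≃ₗ⁅ℝ⁆ u) (α : Complexified u) : Complexified u :=
  (1 / 2 : ℂ) • (α - thetaC θ α)

/-- `𝔤_γ = {x ∈ 𝔤 : [H, x] = (H, γ) x for all H ∈ 𝔥_𝔭}`, with `𝔥_𝔭 = hp ⊗ ℂ`. -/
noncomputable def restrictedRootSpace (hp : Submodule ℝ u) (γ : Complexified u) :
    Submodule ℂ (Complexified u) where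
  carrier := {x | ∀ H ∈ hp.baseChange ℂ, ⁅H, x⁆ = form H γ • x}
  add_mem' := by
    intro a b ha hb H hH
    rw [lie_add, ha H hH, hb H hH, smul_add]
  zero_mem' := by
    intro H _
    rw [lie_zero, smul_zero]
  smul_mem' := by
    intro c a ha H hH
    rw [lie_smul, ha H hH, smul_comm]

/-- The multiplicity `m_γ = dim_ℂ 𝔤_γ`. -/
noncomputable def multiplicity (hp : Submodule ℝ u) (γ : Complexified u) : ℕ :=
  Module.finrank ℂ (restrictedRootSpace hp γ)

/-- The lexicographic ordering `x ≤ y` of the real subspace `V ⊆ 𝔤` with respect to the ordered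
basis `b` of `V`. -/
def lexLE {V : Submodule ℝ (Complexified u)} {n : ℕ} (b : Module.Basis (Fin n) ℝ V)
    (x y : Complexified u) : Prop :=
  ∃ (hx : x ∈ V) (hy : y ∈ V), toLex (b.equivFun ⟨x, hx⟩) ≤ toLex (b.equivFun ⟨y, hy⟩)

/-- The orderings of `𝔥_ℝ` and `𝔥_{𝔭₀}` given by `b` and `c` are compatible: for all roots,
`α ≥ β` implies `ᾱ ≥ β̄`. -/
def Compatible (θ : u ≃ₗ⁅ℝ⁆ u) {hk hp : Submodule ℝ u} {n m : ℕ}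
    (b : Module.Basis (Fin n) ℝ (imag (hk ⊔ hp))) (c : Module.Basis (Fin m) ℝ (imag hp)) : Prop :=
  ∀ α ∈ roots (hk ⊔ hp), ∀ β ∈ roots (hk ⊔ hp), lexLE b β α → lexLE c (bar θ β) (bar θ α)

/-- The positive roots `Δ⁺`. -/
def positiveRoots {W : Submodule ℝ u} {n : ℕ} (b : Module.Basis (Fin n) ℝ (imag W)) :
    Set (Complexified u) :=
  {α | α ∈ roots W ∧ lexLE b 0 α}

/-- The simple roots `Π`: the positive roots that are not a sum of two positive roots. -/
def simpleRoots {W : Submodule ℝ u} {n : ℕ} (b : Module.Basis (Fin n) ℝ (imag W)) :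
    Set (Complexified u) :=
  {α | α ∈ positiveRoots b ∧ ¬ ∃ β ∈ positiveRoots b, ∃ γ ∈ positiveRoots b, α = β + γ}

/-- `δ` is the highest root of `Δ`: the largest one in the ordering. -/
def IsHighestRoot {W : Submodule ℝ u} {n : ℕ} (b : Module.Basis (Fin n) ℝ (imag W))
    (δ : Complexified u) : Prop :=
  δ ∈ roots W ∧ ∀ α ∈ roots W, lexLE b α δ

/-- `Δ₀ = {α ∈ Δ : ᾱ = 0}`. -/
def rootsZero (θ : u ≃ₗ⁅ℝ⁆ u) (W : Submodule ℝ u) : Set (Complexified u) :=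
  {α | α ∈ roots W ∧ bar θ α = 0}

/-- `δ^⊥ = {x ∈ 𝔥_ℝ : (x, δ) = 0}`. -/
def perp (W : Submodule ℝ u) (δ : Complexified u) : Set (Complexified u) :=
  {x | x ∈ imag W ∧ form x δ = 0}

end Complexification

end SymmetricLie

/-! Let e, f be root vectors for δ and −δ. Since (δ̄,δ̄) = ½((δ,δ) − (δ,δ^θ)), both the dichotomy
and (a) ⇔ (b) reduce to `kf_δ_θ_δ`: if δ^θ ≠ −δ then (δ,δ^θ) = 0. In that case [e,θe] = 0, since it
is a vector of 𝔭 commuting with 𝔥_𝔭, hence in 𝔥_𝔭, yet of non-zero weight δ + δ^θ. Also [e,θf] = 0,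
since δ is highest and −δ^θ is positive. So θe and θf are both primitive for the sl₂-triple of δ,
and the opposite numbers ±2(δ,δ^θ)/(δ,δ) are both natural, hence zero.

(b) ⇒ (c): θ is an isometry fixing Δ₀ pointwise. (d) ⇒ (b): e and θf lie in the line 𝔤_δ̄, so their
𝔥-weights δ and −δ^θ agree.

(c) ⇒ (d) is `finrank_restr_δ`. Orthogonality to δ spreads from Π₀ to Δ₀, so root vectors of Δ₀ kill
e. Hence e, together with all that arises from it by applying root vectors of negative restriction,
spans an ideal, which is 𝔤. A vector of the lowest space 𝔤_{−δ̄} is killed by those root vectors, so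
its Killing pairing with e determines it; θ carries 𝔤_{−δ̄} to 𝔤_δ̄.

This runs on the abstract `OrderedRootData`. Compactness supplies the data: negative definiteness
gives non-degeneracy on subspaces defined over ℝ, semisimplicity of ad and, with simplicity of 𝔲,
simplicity of 𝔤. -/

namespace SymmetricLie

/-! ### Real and imaginary parts in 𝔤, and consequences of negative definiteness. -/

section ReIm
variable {u : Type*} [LieRing u] [LieAlgebra ℝ u]

/-- The real part of `x ∈ ℂ ⊗ u`. -/
noncomputable def rePart : Complexified u →ₗ[ℝ] u :=
  (TensorProduct.lid ℝ u).toLinearMap ∘ₗ LinearMap.rTensor u Complex.reLm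

/-- The imaginary part of `x ∈ ℂ ⊗ u`. -/
noncomputable def imPart : Complexified u →ₗ[ℝ] u :=
  (TensorProduct.lid ℝ u).toLinearMap ∘ₗ LinearMap.rTensor u Complex.imLm

@[simp] theorem rePart_tmul (z : ℂ) (a : u) : rePart (z ⊗ₜ[ℝ] a) = z.re • a := by
  simp [rePart]

@[simp] theorem imPart_tmul (z : ℂ) (a : u) : imPart (z ⊗ₜ[ℝ] a) = z.im • a := by
  simp [imPart]

theorem re_add_im (x : Complexified u) :
    (1 : ℂ) ⊗ₜ[ℝ] rePart x + Complex.I ⊗ₜ[ℝ] imPart x = x := by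
  induction x using TensorProduct.induction_on with
  | zero => simp
  | tmul z a =>
    rw [rePart_tmul, imPart_tmul, ← TensorProduct.smul_tmul, ← TensorProduct.smul_tmul,
      ← TensorProduct.add_tmul]
    congr 1
    apply Complex.ext <;> simp
  | add x y hx hy =>
    rw [map_add, map_add, TensorProduct.tmul_add, TensorProduct.tmul_add]
    conv_rhs => rw [← hx, ← hy]
    abel

theorem mem_baseChange_iff (W : Submodule ℝ u) (x : Complexified u) :
    x ∈ W.baseChange ℂ ↔ rePart x ∈ W ∧ imPart x ∈ W := by
  constructor
  · intro hx
    rw [Submodule.baseChange_eq_span] at hx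
    induction hx using Submodule.span_induction with
    | mem x hx =>
      obtain ⟨a, ha, rfl⟩ := hx
      simpa using ha
    | zero => simp
    | add x y _ _ hx hy =>
      rw [map_add, map_add]
      exact ⟨W.add_mem hx.1 hy.1, W.add_mem hx.2 hy.2⟩
    | smul c x _ hx =>
      rw [← re_add_im x]
      simp only [smul_add, TensorProduct.smul_tmul', map_add, rePart_tmul, imPart_tmul]
      exact ⟨W.add_mem (W.smul_mem _ hx.1) (W.smul_mem _ hx.2),
        W.add_mem (W.smul_mem _ hx.1) (W.smul_mem _ hx.2)⟩
  · rintro ⟨h1, h2⟩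
    rw [← re_add_im x]
    exact add_mem (Submodule.tmul_mem_baseChange_of_mem _ h1)
      (Submodule.tmul_mem_baseChange_of_mem _ h2)

theorem form_tmul [Module.Finite ℝ u] (z w : ℂ) (a b : u) :
    form (z ⊗ₜ[ℝ] a) (w ⊗ₜ[ℝ] b) = z * w * (killingForm ℝ u a b : ℂ) := by
  have h : ∀ (z : ℂ) (a : u), z ⊗ₜ[ℝ] a = z • ((1 : ℂ) ⊗ₜ[ℝ] a) := fun z a => by
    rw [TensorProduct.smul_tmul', smul_eq_mul, mul_one]
  rw [h z a, h w b, form, map_smul, map_smul, LinearMap.smul_apply, smul_smul, smul_eq_mul]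
  congr 1
  · ring
  · have had : ∀ a : u, LieAlgebra.ad ℂ (Complexified u) ((1 : ℂ) ⊗ₜ[ℝ] a) =
        (LieAlgebra.ad ℝ u a).baseChange ℂ := LieModule.toEnd_baseChange ℝ ℂ u u
    rw [killingForm_apply_apply, killingForm_apply_apply, had, had, ← LinearMap.baseChange_comp, LinearMap.trace_baseChange]
    rfl

theorem form_comm (x y : Complexified u) : form x y = form y x :=
  LieModule.traceForm_comm _ _ _ x y

theorem form_one_tmul [Module.Finite ℝ u] (x : Complexified u) (c : u) :
    form x ((1 : ℂ) ⊗ₜ[ℝ] c) =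
      ⟨killingForm ℝ u (rePart x) c, killingForm ℝ u (imPart x) c⟩ := by
  conv_lhs => rw [← re_add_im x]
  rw [form, map_add, LinearMap.add_apply]
  change form _ _ + form _ _ = _
  rw [form_tmul, form_tmul]
  apply Complex.ext <;> simp

theorem rePart_lie (x : Complexified u) (c : u) :
    rePart ⁅(1 : ℂ) ⊗ₜ[ℝ] c, x⁆ = ⁅c, rePart x⁆ := by
  induction x using TensorProduct.induction_on with
  | zero =>
    rw [map_zero, lie_zero]
    exact congrArg rePart (lie_zero (L := Complexified u) (M := Complexified u) _)
  | tmul z a => simp [LieAlgebra.ExtendScalars.bracket_tmul]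
  | add x y hx hy =>
    rw [map_add, lie_add, ← hx, ← hy, ← map_add]
    exact congrArg rePart (lie_add (L := Complexified u) (M := Complexified u) _ x y)

theorem imPart_lie (x : Complexified u) (c : u) :
    imPart ⁅(1 : ℂ) ⊗ₜ[ℝ] c, x⁆ = ⁅c, imPart x⁆ := by
  induction x using TensorProduct.induction_on with
  | zero =>
    rw [map_zero, lie_zero]
    exact congrArg imPart (lie_zero (L := Complexified u) (M := Complexified u) _)
  | tmul z a => simp [LieAlgebra.ExtendScalars.bracket_tmul]
  | add x y hx hy =>
    rw [map_add, lie_add, ← hx, ← hy, ← map_add]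
    exact congrArg imPart (lie_add (L := Complexified u) (M := Complexified u) _ x y)

theorem ext_re_im {x y : Complexified u} (h1 : rePart x = rePart y) (h2 : imPart x = imPart y) :
    x = y := by
  rw [← re_add_im x, ← re_add_im y, h1, h2]

theorem one_tmul_mem {W : Submodule ℝ u} {a : u} (ha : a ∈ W) :
    (1 : ℂ) ⊗ₜ[ℝ] a ∈ W.baseChange ℂ :=
  Submodule.tmul_mem_baseChange_of_mem _ ha

/-- The complexification of a maximal abelian subspace of `V` is its own centralizer in `V ⊗ ℂ`. -/
theorem mem_baseChange_of_commute {V W : Submodule ℝ u}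
    (hW : Maximal (fun W : Submodule ℝ u => W ≤ V ∧ IsAbelianSubspace W) W)
    {x : Complexified u} (hxV : x ∈ V.baseChange ℂ)
    (hx : ∀ w ∈ W, ⁅(1 : ℂ) ⊗ₜ[ℝ] w, x⁆ = 0) : x ∈ W.baseChange ℂ := by
  have key : ∀ a ∈ V, (∀ w ∈ W, ⁅w, a⁆ = 0) → a ∈ W := by
    intro a haV ha
    have hle : W ⊔ Submodule.span ℝ {a} ≤ W := by
      refine hW.2 ⟨sup_le hW.1.1 (by simpa using haV), ?_⟩ le_sup_left
      intro x hx y hy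
      obtain ⟨w, hw, s, hs, rfl⟩ := Submodule.mem_sup.1 hx
      obtain ⟨w', hw', s', hs', rfl⟩ := Submodule.mem_sup.1 hy
      obtain ⟨r, rfl⟩ := Submodule.mem_span_singleton.1 hs
      obtain ⟨r', rfl⟩ := Submodule.mem_span_singleton.1 hs'
      have h1 : ⁅a, w'⁆ = 0 := by rw [← lie_skew, ha w' hw', neg_zero]
      simp [hW.1.2 w hw w' hw', ha w hw, h1]
    exact hle (Submodule.mem_sup_right (Submodule.mem_span_singleton_self a))
  rw [mem_baseChange_iff] at hxV ⊢
  refine ⟨key _ hxV.1 fun w hw => ?_, key _ hxV.2 fun w hw => ?_⟩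
  · rw [← rePart_lie, hx w hw, map_zero]
  · rw [← imPart_lie, hx w hw, map_zero]

theorem IsCompact.eq_zero (hu : IsCompact u) {x : u} (hx : killingForm ℝ u x x = 0) : x = 0 := by
  by_contra h
  exact (hu x h).ne hx

/-- The Killing form is non-degenerate on `W ⊗ ℂ`. -/
theorem IsCompact.form_nondegenerate [Module.Finite ℝ u] (hu : IsCompact u) {W : Submodule ℝ u}
    {x : Complexified u}
    (hx : x ∈ W.baseChange ℂ) (h : ∀ y ∈ W.baseChange ℂ, form x y = 0) : x = 0 := by
  rw [mem_baseChange_iff] at hx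
  -- Pairing x with its own real and imaginary parts exposes the Killing norms of both.
  have h1 := h _ (one_tmul_mem hx.1)
  have h2 := h _ (one_tmul_mem hx.2)
  rw [form_one_tmul] at h1 h2
  apply ext_re_im
  · rw [map_zero]; exact hu.eq_zero (congrArg Complex.re h1)
  · rw [map_zero]; exact hu.eq_zero (congrArg Complex.im h2)

theorem IsCompact.isKilling [Module.Finite ℝ u] (hu : IsCompact u) :
    LieAlgebra.IsKilling ℂ (Complexified u) := by
  constructor
  rw [eq_bot_iff]
  intro x hx
  rw [LieIdeal.mem_killingCompl] at hx
  rw [LieSubmodule.mem_bot]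
  refine hu.form_nondegenerate (W := ⊤) (by simp) fun y _ => ?_
  rw [form_comm]
  exact hx y trivial

/-- `ad H` is semisimple for `H ∈ u`. -/
theorem IsCompact.lie_eq_zero_of_lie_lie_eq_zero (hu : IsCompact u) {h x : u}
    (hx : ⁅h, ⁅h, x⁆⁆ = 0) : ⁅h, x⁆ = 0 := by
  apply hu.eq_zero
  have : killingForm ℝ u ⁅x, h⁆ ⁅h, x⁆ = killingForm ℝ u x ⁅h, ⁅h, x⁆⁆ :=
    LieModule.traceForm_apply_lie_apply ℝ u u x h ⁅h, x⁆
  rw [hx, map_zero, ← lie_skew h x, map_neg, neg_eq_zero] at this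
  rw [← lie_skew h x, map_neg, LinearMap.map_neg₂, this, neg_zero, neg_zero]

end ReIm

/-! ### Simplicity of the complexification. -/

section Simple
variable {u : Type*} [LieRing u] [LieAlgebra ℝ u]

/-- A compact Lie algebra has no complex structure commuting with the adjoint action. -/
theorem IsCompact.no_complex_structure [Nontrivial u] (hu : IsCompact u) (J : u →ₗ[ℝ] u)
    (hJ : ∀ a, J (J a) = -a) (hlie : ∀ a c, J ⁅a, c⁆ = ⁅J a, c⁆) : False := by
  obtain ⟨a, ha⟩ := exists_ne (0 : u)
  have hlie' : ∀ a c, ⁅a, J c⁆ = J ⁅a, c⁆ := fun a c => by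
    rw [← lie_skew, ← hlie, ← map_neg, lie_skew]
  -- ad(Ja) = J ∘ ad a and J commutes with ad a, so ad(Ja)² = −(ad a)². This contradicts
  -- definiteness.
  have h : killingForm ℝ u (J a) (J a) = - killingForm ℝ u a a := by
    rw [killingForm_apply_apply, killingForm_apply_apply, ← map_neg]
    congr 1
    ext c
    simp [hlie', ← hlie, hJ]
  have hJa : J a ≠ 0 := fun h0 => ha (by rw [← neg_eq_zero, ← hJ, h0, map_zero])
  have h1 := hu a ha
  have h2 := hu _ hJa
  linarith

/-- The complexification of a compact simple Lie algebra is simple. -/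
theorem IsCompact.lieIdeal_eq_top [LieAlgebra.IsSimple ℝ u] (hu : IsCompact u)
    (I : LieIdeal ℂ (Complexified u)) (hI : I ≠ ⊥) : I = ⊤ := by
  have : Nontrivial u := by
    by_contra h
    rw [not_nontrivial_iff_subsingleton] at h
    exact LieAlgebra.IsSimple.non_abelian ℝ (L := u) ⟨fun _ _ => Subsingleton.elim _ _⟩
  -- The real points of I form an ideal of 𝔲, so they are everything or nothing.
  let R : LieIdeal ℝ u :=
    { carrier := {a | (1 : ℂ) ⊗ₜ[ℝ] a ∈ I}
      add_mem' := fun {a b} ha hb => by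
        simp only [Set.mem_ofPred_eq, TensorProduct.tmul_add] at *
        exact add_mem ha hb
      zero_mem' := by simp
      smul_mem' := fun r a ha => by
        simp only [Set.mem_ofPred_eq, TensorProduct.tmul_smul] at *
        exact I.smul_mem (r : ℂ) ha
      lie_mem := fun {c a} ha => by
        have := I.lie_mem (x := (1 : ℂ) ⊗ₜ[ℝ] c) ha
        simpa [LieAlgebra.ExtendScalars.bracket_tmul] using this }
  have hRmem : ∀ a, a ∈ R ↔ (1 : ℂ) ⊗ₜ[ℝ] a ∈ I := fun a => Iff.rfl
  have hImul : ∀ x y : u, (1 : ℂ) ⊗ₜ[ℝ] x + Complex.I ⊗ₜ[ℝ] y ∈ I →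
      (1 : ℂ) ⊗ₜ[ℝ] (-y) + Complex.I ⊗ₜ[ℝ] x ∈ I := by
    intro x y h
    have := I.smul_mem Complex.I h
    rw [smul_add, TensorProduct.smul_tmul', TensorProduct.smul_tmul', smul_eq_mul, smul_eq_mul,
      Complex.I_mul_I, mul_one, TensorProduct.neg_tmul, ← TensorProduct.tmul_neg, add_comm] at this
    exact this
  rcases LieAlgebra.IsSimple.eq_bot_or_eq_top (R := ℝ) R with hR | hR
  · exfalso
    -- The real parts of I form a non-zero ideal, hence 𝔲. Without real points, I is then the graph
    -- of a map J, and stability of I under i and ad makes J a complex structure.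
    let P : LieIdeal ℝ u :=
      { carrier := {a | ∃ b, (1 : ℂ) ⊗ₜ[ℝ] a + Complex.I ⊗ₜ[ℝ] b ∈ I}
        add_mem' := fun {a a'} ⟨b, hb⟩ ⟨b', hb'⟩ => ⟨b + b', by
          rw [TensorProduct.tmul_add, TensorProduct.tmul_add, add_add_add_comm]
          exact add_mem hb hb'⟩
        zero_mem' := ⟨0, by simp⟩
        smul_mem' := fun r a ⟨b, hb⟩ => ⟨r • b, by
          rw [TensorProduct.tmul_smul, TensorProduct.tmul_smul, ← smul_add]
          exact I.smul_mem (r : ℂ) hb⟩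
        lie_mem := fun {c a} ⟨b, hb⟩ => ⟨⁅c, b⁆, by
          have := I.lie_mem (x := (1 : ℂ) ⊗ₜ[ℝ] c) hb
          simpa [LieAlgebra.ExtendScalars.bracket_tmul] using this⟩ }
    have hP : P = ⊤ := by
      refine (LieAlgebra.IsSimple.eq_bot_or_eq_top (R := ℝ) P).resolve_left fun hP => hI ?_
      rw [eq_bot_iff]
      intro x hx
      have h1 : rePart x ∈ P := ⟨imPart x, by rwa [re_add_im]⟩
      rw [← re_add_im x] at hx
      have h2 : -imPart x ∈ P := ⟨_, hImul _ _ hx⟩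
      rw [hP, LieSubmodule.mem_bot] at h1 h2
      rw [LieSubmodule.mem_bot]
      exact ext_re_im (by rw [h1, map_zero]) (by rw [neg_eq_zero.1 h2, map_zero])
    have hex : ∀ a, ∃ b, (1 : ℂ) ⊗ₜ[ℝ] a + Complex.I ⊗ₜ[ℝ] b ∈ I := fun a => by
      have : a ∈ P := by rw [hP]; trivial
      exact this
    have huniq : ∀ a b b' : u, (1 : ℂ) ⊗ₜ[ℝ] a + Complex.I ⊗ₜ[ℝ] b ∈ I →
        (1 : ℂ) ⊗ₜ[ℝ] a + Complex.I ⊗ₜ[ℝ] b' ∈ I → b = b' := by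
      intro a b b' h h'
      have h3 := sub_mem (hImul _ _ h) (hImul _ _ h')
      rw [add_sub_add_right_eq_sub, ← TensorProduct.tmul_sub, ← hRmem, hR,
        LieSubmodule.mem_bot] at h3
      have : b' - b = 0 := by rw [← h3]; abel
      exact (sub_eq_zero.1 this).symm
    choose J hJ using hex
    refine hu.no_complex_structure
      { toFun := J
        map_add' := fun a a' => huniq _ _ _ (hJ _) (by
          rw [TensorProduct.tmul_add, TensorProduct.tmul_add, add_add_add_comm]
          exact add_mem (hJ a) (hJ a'))
        map_smul' := fun r a => huniq _ _ _ (hJ _) (by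
          rw [TensorProduct.tmul_smul, TensorProduct.tmul_smul, RingHom.id_apply, ← smul_add]
          exact I.smul_mem ((RingHom.id ℝ r : ℝ) : ℂ) (hJ a)) }
      (fun a => ?_) fun a c => ?_
    · have h := I.smul_mem (-1 : ℂ) (hImul _ _ (hJ a))
      refine huniq _ _ _ (hJ _) ?_
      rw [neg_one_smul, neg_add, ← TensorProduct.tmul_neg, neg_neg, ← TensorProduct.tmul_neg] at h
      exact h
    · refine huniq _ _ _ (hJ _) ?_
      have h := I.lie_mem (x := (1 : ℂ) ⊗ₜ[ℝ] c) (hJ a)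
      have h : -⁅(1 : ℂ) ⊗ₜ[ℝ] c, (1 : ℂ) ⊗ₜ[ℝ] a + Complex.I ⊗ₜ[ℝ] J a⁆ ∈ I := neg_mem h
      rw [lie_skew, add_lie] at h
      simpa [LieAlgebra.ExtendScalars.bracket_tmul] using h
  · rw [eq_top_iff]
    intro x _
    have h : ∀ a, (1 : ℂ) ⊗ₜ[ℝ] a ∈ I := fun a => by
      rw [← hRmem, hR]; trivial
    rw [← re_add_im x]
    refine add_mem (h _) ?_
    have := I.smul_mem Complex.I (h (imPart x))
    rwa [TensorProduct.smul_tmul', smul_eq_mul, mul_one] at this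

end Simple

/-! ### Weight vectors and sl₂-triples for a θ-stable Cartan subalgebra. -/

section Abstract
variable {L : Type*} [LieRing L] [LieAlgebra ℂ L]

/-- The joint eigenspace of `ad T` for the functional represented by `a` through the Killing
form. -/
noncomputable def weightSpace (T : Submodule ℂ L) (a : L) : Submodule ℂ L where
  carrier := {x | ∀ H ∈ T, ⁅H, x⁆ = killingForm ℂ L H a • x}
  add_mem' := by
    intro x y hx hy H hH
    rw [lie_add, hx H hH, hy H hH, smul_add]
  zero_mem' := by
    intro H _
    rw [lie_zero, smul_zero]
  smul_mem' := by
    intro c x hx H hH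
    rw [lie_smul, hx H hH, smul_comm]

/-- `a` is a root with respect to `T`. -/
def IsRootOf (T : Submodule ℂ L) (a : L) : Prop :=
  a ∈ T ∧ a ≠ 0 ∧ ∃ x, x ≠ 0 ∧ x ∈ weightSpace T a

/-- `(a - θ a) / 2`. -/
noncomputable def restr (θ : L ≃ₗ⁅ℂ⁆ L) (a : L) : L := (1 / 2 : ℂ) • (a - θ a)

theorem restr_add (θ : L ≃ₗ⁅ℂ⁆ L) (a b : L) : restr θ (a + b) = restr θ a + restr θ b := by
  simp only [restr, map_add]; module

theorem restr_neg (θ : L ≃ₗ⁅ℂ⁆ L) (a : L) : restr θ (-a) = -restr θ a := by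
  simp only [restr, map_neg]; module

theorem kf_lie (x y z : L) : killingForm ℂ L ⁅x, y⁆ z = killingForm ℂ L x ⁅y, z⁆ :=
  LieModule.traceForm_apply_lie_apply ℂ L L x y z

theorem kf_comm (x y : L) : killingForm ℂ L x y = killingForm ℂ L y x :=
  LieModule.traceForm_comm ℂ L L x y

theorem lie_mem_weightSpace {T : Submodule ℂ L} {a b x y : L} (hx : x ∈ weightSpace T a)
    (hy : y ∈ weightSpace T b) : ⁅x, y⁆ ∈ weightSpace T (a + b) := by
  intro H hH
  rw [leibniz_lie, hx H hH, hy H hH, smul_lie, lie_smul, map_add, add_smul]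

/-- Weight vectors pair to zero unless their weights are opposite. -/
theorem kf_add_eq_zero {T : Submodule ℂ L} {a b x y : L} (hx : x ∈ weightSpace T a)
    (hy : y ∈ weightSpace T b) (hxy : killingForm ℂ L x y ≠ 0) :
    ∀ H ∈ T, killingForm ℂ L (a + b) H = 0 := by
  intro H hH
  have h2 : killingForm ℂ L ⁅H, x⁆ y = - killingForm ℂ L x ⁅H, y⁆ := by
    rw [← lie_skew, map_neg, LinearMap.neg_apply, kf_lie]
  rw [hx H hH, hy H hH] at h2
  simp only [map_smul, LinearMap.smul_apply, smul_eq_mul] at h2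
  rw [kf_comm, map_add]
  have h3 : (killingForm ℂ L H a + killingForm ℂ L H b) * killingForm ℂ L x y = 0 := by
    linear_combination h2
  exact (mul_eq_zero.1 h3).resolve_right hxy

/-- A simple Lie algebra with an involution `θ` and a `θ`-stable maximally split Cartan subalgebra
`h` with split part `hp`. -/
structure SplitCartanData (L : Type*) [LieRing L] [LieAlgebra ℂ L] where
  h : Submodule ℂ L
  hp : Submodule ℂ L
  θ : L ≃ₗ⁅ℂ⁆ L
  hp_le : hp ≤ h
  hp_ne_bot : hp ≠ ⊥
  θ_θ : ∀ x, θ (θ x) = x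
  θ_mem : ∀ x ∈ h, θ x ∈ h
  θ_hp : ∀ x ∈ hp, θ x = -x
  lie_eq_zero : ∀ x ∈ h, ∀ y ∈ h, ⁅x, y⁆ = 0
  mem_h : ∀ x, (∀ y ∈ h, ⁅y, x⁆ = 0) → x ∈ h
  mem_hp : ∀ x, θ x = -x → (∀ y ∈ hp, ⁅y, x⁆ = 0) → x ∈ hp
  nondeg : ∀ x, (∀ y, killingForm ℂ L x y = 0) → x = 0
  nondeg_h : ∀ x ∈ h, (∀ y ∈ h, killingForm ℂ L x y = 0) → x = 0
  nondeg_hp : ∀ x ∈ hp, (∀ y ∈ hp, killingForm ℂ L x y = 0) → x = 0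
  weightSpaces_span : ∀ p : Submodule ℂ L, (∀ a ∈ h, weightSpace h a ≤ p) → ∀ x, x ∈ p
  ideal_eq_top : ∀ I : LieIdeal ℂ L, I ≠ ⊥ → I = ⊤
  finite_roots : {a | IsRootOf h a}.Finite
  root_sq_ne_zero : ∀ a, IsRootOf h a → killingForm ℂ L a a ≠ 0

namespace SplitCartanData
variable (D : SplitCartanData L)

local notation "κ" => killingForm ℂ L

theorem kf_θ [Module.Finite ℂ L] (x y : L) : κ (D.θ x) y = κ x (D.θ y) := by
  rw [← LieAlgebra.killingForm_of_equiv_apply D.θ x, D.θ_θ]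

theorem restr_mem {a : L} (ha : a ∈ D.h) : restr D.θ a ∈ D.hp := by
  apply D.mem_hp
  · simp only [restr, map_smul, map_sub, D.θ_θ]; module
  · intro y hy
    rw [restr, lie_smul, lie_sub, D.lie_eq_zero _ (D.hp_le hy) _ ha,
      D.lie_eq_zero _ (D.hp_le hy) _ (D.θ_mem _ ha), sub_zero, smul_zero]

theorem kf_restr [Module.Finite ℂ L] {H : L} (hH : H ∈ D.hp) (a : L) :
    κ H (restr D.θ a) = κ H a := by
  rw [restr, map_smul, map_sub, ← D.kf_θ, D.θ_hp H hH, map_neg, LinearMap.neg_apply, smul_eq_mul]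
  ring

theorem mem_restr [Module.Finite ℂ L] {a x : L} (hx : x ∈ weightSpace D.h a) :
    x ∈ weightSpace D.hp (restr D.θ a) := by
  intro H hH
  rw [D.kf_restr hH, hx H (D.hp_le hH)]

theorem θ_mem_weightSpace [Module.Finite ℂ L] {T : Submodule ℂ L} (hT : ∀ H ∈ T, D.θ H ∈ T)
    {a x : L} (hx : x ∈ weightSpace T a) : D.θ x ∈ weightSpace T (D.θ a) := by
  intro H hH
  have := congrArg D.θ (hx _ (hT H hH))
  rwa [LieEquiv.map_lie, D.θ_θ, map_smul, D.kf_θ] at this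

theorem θ_mem_hp {H : L} (hH : H ∈ D.hp) : D.θ H ∈ D.hp := by
  rw [D.θ_hp H hH]; exact neg_mem hH

theorem mem_weightSpace_zero {x : L} : x ∈ weightSpace D.h 0 ↔ x ∈ D.h := by
  constructor
  · intro hx
    refine D.mem_h x fun y hy => ?_
    rw [hx y hy, map_zero, zero_smul]
  · intro hx H hH
    rw [D.lie_eq_zero H hH x hx, map_zero, zero_smul]

theorem eq_zero_of_kf {x : L} (hx : ∀ a ∈ D.h, ∀ z ∈ weightSpace D.h a, κ x z = 0) : x = 0 := by
  apply D.nondeg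
  intro y
  exact D.weightSpaces_span (LinearMap.ker (κ x)) (fun a ha z hz => hx a ha z hz) y

theorem weight_unique {a b x : L} (ha : a ∈ D.h) (hb : b ∈ D.h) (hx : x ≠ 0)
    (hxa : x ∈ weightSpace D.h a) (hxb : x ∈ weightSpace D.h b) : a = b := by
  rw [← sub_eq_zero]
  refine D.nondeg_h _ (sub_mem ha hb) fun H hH => ?_
  have h1 := hxa H hH
  rw [hxb H hH] at h1
  have h2 := smul_left_injective ℂ hx h1
  rw [kf_comm, map_sub, h2, sub_self]

theorem root_or_zero {a x : L} (ha : a ∈ D.h) (hx : x ≠ 0) (hxa : x ∈ weightSpace D.h a) :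
    IsRootOf D.h a ∨ a = 0 := by
  by_cases h : a = 0
  · exact Or.inr h
  · exact Or.inl ⟨ha, h, x, hx, hxa⟩

/-- Since x is orthogonal to every weight space except that of −a, failure here would put x in the
radical of the Killing form. -/
theorem exists_dual {a x : L} (ha : a ∈ D.h) (hx : x ≠ 0) (hxa : x ∈ weightSpace D.h a) :
    ∃ z ∈ weightSpace D.h (-a), κ x z = 1 := by
  by_contra! hcon
  refine hx (D.eq_zero_of_kf fun b hb z hz => ?_)
  by_contra hxz
  have hab : a + b = 0 := D.nondeg_h _ (add_mem ha hb) (kf_add_eq_zero hxa hz hxz)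
  rw [eq_neg_of_add_eq_zero_right hab] at hz
  apply hcon ((κ x z)⁻¹ • z) (Submodule.smul_mem _ _ hz)
  rw [map_smul, smul_eq_mul, inv_mul_cancel₀ hxz]

theorem root_neg {a : L} (ha : IsRootOf D.h a) : IsRootOf D.h (-a) := by
  obtain ⟨ha1, ha2, x, hx, hxa⟩ := ha
  obtain ⟨z, hz, hxz⟩ := D.exists_dual ha1 hx hxa
  refine ⟨neg_mem ha1, neg_ne_zero.2 ha2, z, ?_, hz⟩
  rintro rfl
  simp at hxz

theorem root_θ [Module.Finite ℂ L] {a : L} (ha : IsRootOf D.h a) : IsRootOf D.h (D.θ a) := by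
  obtain ⟨ha1, ha2, x, hx, hxa⟩ := ha
  refine ⟨D.θ_mem _ ha1, fun h => ha2 (by rw [← D.θ_θ a, h, map_zero]), D.θ x,
    fun h => hx (by rw [← D.θ_θ x, h, map_zero]), D.θ_mem_weightSpace D.θ_mem hxa⟩

/-- Root vectors of `a` and `-a` can be completed to an `sl₂`-triple. -/
theorem exists_sl2 {a : L} (ha : IsRootOf D.h a) :
    ∃ e f, e ≠ 0 ∧ f ≠ 0 ∧ e ∈ weightSpace D.h a ∧ f ∈ weightSpace D.h (-a) ∧
      IsSl2Triple ((2 / κ a a) • a) e f := by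
  have hc := D.root_sq_ne_zero a ha
  obtain ⟨ha1, ha2, x, hx, hxa⟩ := ha
  obtain ⟨z, hz, hxz⟩ := D.exists_dual ha1 hx hxa
  have hz0 : z ≠ 0 := by
    rintro rfl
    simp at hxz
  have h2 : 2 / κ a a ≠ 0 := div_ne_zero two_ne_zero hc
  -- By invariance κ([x,z],H) = κ(H,a) κ(x,z) for H in the Cartan subalgebra, and κ(x,z) = 1.
  have hlie : ⁅x, z⁆ = a := by
    have h0 : ⁅x, z⁆ ∈ D.h := by
      rw [← D.mem_weightSpace_zero, ← add_neg_cancel a]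
      exact lie_mem_weightSpace hxa hz
    rw [← sub_eq_zero]
    refine D.nondeg_h _ (sub_mem h0 ha1) fun H hH => ?_
    rw [map_sub, LinearMap.sub_apply, kf_lie, ← lie_skew, hz H hH, map_neg, map_smul, hxz,
      map_neg, kf_comm H a]
    simp
  refine ⟨x, (2 / κ a a) • z, hx, smul_ne_zero h2 hz0, hxa, Submodule.smul_mem _ _ hz,
    smul_ne_zero h2 ha2, ?_, ?_, ?_⟩
  · rw [lie_smul, hlie]
  · rw [smul_lie, hxa a ha1, smul_smul, div_mul_cancel₀ _ hc, two_smul, two_smul]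
  · rw [smul_lie, lie_smul, hz a ha1, map_neg, smul_smul, smul_smul, mul_right_comm,
      mul_neg, div_mul_cancel₀ _ hc, neg_mul, neg_smul, mul_smul, two_smul, two_smul]

theorem weight_nat [Module.Finite ℂ L] {a b e f x : L}
    (t : IsSl2Triple ((2 / κ a a) • a) e f) (ha : a ∈ D.h)
    (hx : x ≠ 0) (hxb : x ∈ weightSpace D.h b) (hex : ⁅e, x⁆ = 0) :
    ∃ n : ℕ, 2 / κ a a * κ a b = n := by
  have hp : t.HasPrimitiveVectorWith x (2 / κ a a * κ a b) :=
    ⟨hx, by rw [smul_lie, hxb a ha, smul_smul], hex⟩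
  exact hp.exists_nat

/-- A lowest weight vector of weight 0 spans a trivial sl₂-module. The reversed triple turns it into
a primitive vector. -/
theorem lie_eq_zero_of_weight_zero [Module.Finite ℂ L] {a b e f x : L}
    (t : IsSl2Triple ((2 / κ a a) • a) e f) (ha : a ∈ D.h)
    (hxb : x ∈ weightSpace D.h b) (hab : κ a b = 0) (hfx : ⁅f, x⁆ = 0) : ⁅e, x⁆ = 0 := by
  by_cases hx : x = 0
  · rw [hx, lie_zero]
  have hp : t.symm.HasPrimitiveVectorWith x (0 : ℂ) :=
    ⟨hx, by rw [neg_lie, smul_lie, hxb a ha, hab, zero_smul, smul_zero, neg_zero], hfx⟩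
  have := hp.pow_toEnd_f_eq_zero_of_eq_nat (n := 0) (by simp)
  simpa using this

theorem restr_neg_θ (a : L) : restr D.θ (-D.θ a) = restr D.θ a := by
  simp only [restr, map_neg, D.θ_θ]; module

theorem kf_restr_restr [Module.Finite ℂ L] (a : L) :
    κ (restr D.θ a) (restr D.θ a) = (1 / 2 : ℂ) * (κ a a - κ a (D.θ a)) := by
  have h1 : κ (D.θ a) (D.θ a) = κ a a := LieAlgebra.killingForm_of_equiv_apply D.θ a a
  simp only [restr, map_smul, map_sub, LinearMap.smul_apply, LinearMap.sub_apply, smul_eq_mul]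
  rw [h1, kf_comm (D.θ a) a]
  ring

/-- Roots with zero restriction are fixed by `θ`. -/
theorem θ_eq_of_restr_eq_zero {a : L} (ha : restr D.θ a = 0) : D.θ a = a := by
  rw [restr, smul_eq_zero_iff_right (by norm_num), sub_eq_zero] at ha
  exact ha.symm

end SplitCartanData
end Abstract

/-! ### Consequences of the ordering for the highest root. -/

section Order
variable {L : Type*} [LieRing L] [LieAlgebra ℂ L]

/-- Positive cones `P`, `Q` for compatible orderings of the roots and of the restricted roots, for
which `δ` is the highest root. -/
structure OrderedRootData (L : Type*) [LieRing L] [LieAlgebra ℂ L] extends SplitCartanData L where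
  P : Set L
  Q : Set L
  δ : L
  P_add : ∀ x ∈ P, ∀ y ∈ P, x + y ∈ P
  P_antisymm : ∀ x ∈ P, -x ∈ P → x = 0
  P_total : ∀ a, IsRootOf h a → a ∈ P ∨ -a ∈ P
  Q_antisymm : ∀ x ∈ Q, -x ∈ Q → x = 0
  Q_add : ∀ x ∈ Q, ∀ y ∈ Q, x + y ∈ Q
  δ_root : IsRootOf h δ
  δ_highest : ∀ a, IsRootOf h a → δ - a ∈ P
  restr_mem_Q : ∀ a, IsRootOf h a → a ∈ P → restr θ a ∈ Q
  restr_le : ∀ a, IsRootOf h a → restr θ δ - restr θ a ∈ Q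

namespace OrderedRootData
variable (D : OrderedRootData L)

local notation "κ" => killingForm ℂ L

theorem δ_mem_P : D.δ ∈ D.P := by
  refine (D.P_total _ D.δ_root).resolve_right fun h => D.δ_root.2.1 ?_
  have h1 := D.δ_highest _ (D.root_neg D.δ_root)
  rw [sub_neg_eq_add] at h1
  have h2 : D.δ + D.δ = 0 := by
    refine D.P_antisymm _ h1 ?_
    rw [neg_add]
    exact D.P_add _ h _ h
  rwa [← two_smul ℂ, smul_eq_zero_iff_right two_ne_zero] at h2

/-- If δ̄ = 0, maximality applied to each root and its negative makes all restricted roots vanish.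
Then 𝔥_𝔭 acts by zero and lies in the Killing radical, although it is non-zero. -/
theorem restr_δ_ne_zero [Module.Finite ℂ L] : restr D.θ D.δ ≠ 0 := by
  intro h0
  have hr : ∀ a, IsRootOf D.h a → restr D.θ a = 0 := by
    intro a ha
    have h1 := D.restr_le a ha
    have h2 := D.restr_le _ (D.root_neg ha)
    rw [h0, zero_sub] at h1 h2
    rw [restr_neg, neg_neg] at h2
    exact D.Q_antisymm _ h2 h1
  apply D.hp_ne_bot
  rw [eq_bot_iff]
  intro H hH
  rw [Submodule.mem_bot]
  have had : LieAlgebra.ad ℂ L H = 0 := by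
    ext x
    refine D.weightSpaces_span (LinearMap.ker (LieAlgebra.ad ℂ L H)) (fun a ha x hx => ?_) x
    rw [LinearMap.mem_ker, LieAlgebra.ad_apply, hx H (D.hp_le hH)]
    by_cases hx0 : x = 0
    · rw [hx0, smul_zero]
    · rcases D.root_or_zero ha hx0 hx with h | h
      · rw [← D.kf_restr hH, hr a h, map_zero, zero_smul]
      · rw [h, map_zero, zero_smul]
  apply D.nondeg
  intro y
  rw [killingForm_apply_apply, had, LinearMap.zero_comp, map_zero]

theorem restr_δ_mem_Q : restr D.θ D.δ ∈ D.Q := D.restr_mem_Q _ D.δ_root D.δ_mem_P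

theorem root_ε [Module.Finite ℂ L] : IsRootOf D.h (-D.θ D.δ) := D.root_neg (D.root_θ D.δ_root)

/-- −δ^θ has the same restriction δ̄ > 0 as δ, and compatibility transfers the sign back. -/
theorem neg_θ_δ_mem_P [Module.Finite ℂ L] : -D.θ D.δ ∈ D.P := by
  refine (D.P_total _ D.root_ε).resolve_right fun h => D.restr_δ_ne_zero ?_
  refine D.Q_antisymm _ D.restr_δ_mem_Q ?_
  have := D.restr_mem_Q _ (D.root_neg D.root_ε) h
  rwa [restr_neg, D.restr_neg_θ] at this

/-- The sum of the highest root and a positive root is not a weight. -/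
theorem weightSpace_δ_add {b x : L} (hb : IsRootOf D.h b) (hbP : b ∈ D.P)
    (hx : x ∈ weightSpace D.h (D.δ + b)) : x = 0 := by
  by_contra hx0
  rcases D.root_or_zero (add_mem D.δ_root.1 hb.1) hx0 hx with h | h
  · have h1 := D.δ_highest _ h
    rw [sub_add_cancel_left] at h1
    exact hb.2.1 (D.P_antisymm _ hbP h1)
  · rw [eq_neg_of_add_eq_zero_right h] at hbP
    exact D.δ_root.2.1 (D.P_antisymm _ D.δ_mem_P hbP)

theorem weightSpace_neg_δ_add {b x : L} (hb : IsRootOf D.h b) (hbP : -b ∈ D.P)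
    (hx : x ∈ weightSpace D.h (-D.δ + b)) : x = 0 := by
  by_contra hx0
  obtain ⟨z, hz, hxz⟩ := D.exists_dual (add_mem (neg_mem D.δ_root.1) hb.1) hx0 hx
  rw [neg_add, neg_neg] at hz
  rw [D.weightSpace_δ_add (D.root_neg hb) hbP hz, map_zero] at hxz
  exact zero_ne_one hxz

/-- If `δ^θ ≠ -δ` then `δ` and `δ^θ` are orthogonal. -/
theorem kf_δ_θ_δ [Module.Finite ℂ L] (h : D.θ D.δ ≠ -D.δ) : κ D.δ (D.θ D.δ) = 0 := by
  obtain ⟨e, f, he0, hf0, he, hf, t⟩ := D.exists_sl2 D.δ_root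
  have hθ0 : ∀ x, x ≠ 0 → D.θ x ≠ 0 := fun x hx h => hx (by rw [← D.θ_θ x, h, map_zero])
  have h1 : ⁅e, D.θ e⁆ = 0 := by
    by_contra h0
    have hmem := lie_mem_weightSpace he (D.θ_mem_weightSpace D.θ_mem he)
    -- θ swaps the two entries, so the bracket is in the −1 eigenspace; its weight δ + δ^θ vanishes
    -- on 𝔥_𝔭.
    have hhp : ⁅e, D.θ e⁆ ∈ D.hp := by
      apply D.mem_hp
      · rw [LieEquiv.map_lie, D.θ_θ, lie_skew]
      · intro y hy
        rw [hmem y (D.hp_le hy), map_add, ← D.kf_θ, D.θ_hp y hy, map_neg, LinearMap.neg_apply,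
          add_neg_cancel, zero_smul]
    have h2 := D.weight_unique (add_mem D.δ_root.1 (D.θ_mem _ D.δ_root.1)) (zero_mem _) h0 hmem
      (D.mem_weightSpace_zero.2 (D.hp_le hhp))
    exact h (eq_neg_of_add_eq_zero_right h2)
  have h2 : ⁅e, D.θ f⁆ = 0 := by
    have hmem := D.θ_mem_weightSpace D.θ_mem hf
    rw [map_neg] at hmem
    exact D.weightSpace_δ_add D.root_ε D.neg_θ_δ_mem_P (lie_mem_weightSpace he hmem)
  obtain ⟨n, hn⟩ := D.weight_nat t D.δ_root.1 (hθ0 e he0) (D.θ_mem_weightSpace D.θ_mem he) h1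
  obtain ⟨m, hm⟩ := D.weight_nat t D.δ_root.1 (hθ0 f hf0) (D.θ_mem_weightSpace D.θ_mem hf) h2
  rw [map_neg, map_neg, mul_neg, hn] at hm
  have hnm : n + m = 0 := by
    have : ((n + m : ℕ) : ℂ) = 0 := by rw [Nat.cast_add, ← hm, add_neg_cancel]
    exact_mod_cast this
  have hn0 : n = 0 := by omega
  rw [hn0, Nat.cast_zero] at hn
  exact (mul_eq_zero.1 hn).resolve_left
    (div_ne_zero two_ne_zero (D.root_sq_ne_zero _ D.δ_root))

theorem kf_restr_δ_of_eq [Module.Finite ℂ L] (h : D.θ D.δ = -D.δ) :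
    κ (restr D.θ D.δ) (restr D.θ D.δ) = κ D.δ D.δ := by
  rw [D.kf_restr_restr, h, map_neg]; ring

theorem kf_restr_δ_of_ne [Module.Finite ℂ L] (h : D.θ D.δ ≠ -D.δ) :
    κ (restr D.θ D.δ) (restr D.θ D.δ) = (1 / 2 : ℂ) * κ D.δ D.δ := by
  rw [D.kf_restr_restr, D.kf_δ_θ_δ h, sub_zero]

theorem kf_restr_δ_iff [Module.Finite ℂ L] :
    κ (restr D.θ D.δ) (restr D.θ D.δ) = κ D.δ D.δ ↔ D.θ D.δ = -D.δ := by
  refine ⟨fun h => ?_, D.kf_restr_δ_of_eq⟩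
  by_contra hne
  rw [D.kf_restr_δ_of_ne hne] at h
  apply D.root_sq_ne_zero _ D.δ_root
  linear_combination (-2 : ℂ) * h

theorem kf_eq_zero_of_θ_δ [Module.Finite ℂ L] (h : D.θ D.δ = -D.δ) {a : L}
    (ha : restr D.θ a = 0) : κ a D.δ = 0 := by
  have h1 := LieAlgebra.killingForm_of_equiv_apply D.θ a D.δ
  rw [D.θ_eq_of_restr_eq_zero ha, h, map_neg] at h1
  exact self_eq_neg.1 h1.symm

/-- If the simple roots with zero restriction are orthogonal to `δ`, so are all roots with zero
restriction. -/
theorem kf_eq_zero_of_simple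
    (hs : ∀ a, IsRootOf D.h a → a ∈ D.P →
      (¬ ∃ b, (IsRootOf D.h b ∧ b ∈ D.P) ∧ ∃ c, (IsRootOf D.h c ∧ c ∈ D.P) ∧ a = b + c) →
      restr D.θ a = 0 → κ a D.δ = 0) {a : L} (ha : IsRootOf D.h a) (har : restr D.θ a = 0) :
    κ a D.δ = 0 := by
  -- Induction on the number of positive roots b ≤ a. This drops strictly for a summand of a, since
  -- a itself is no longer counted.
  have key : ∀ n : ℕ, ∀ a, IsRootOf D.h a → a ∈ D.P → restr D.θ a = 0 →
      {b | IsRootOf D.h b ∧ b ∈ D.P ∧ a - b ∈ D.P}.ncard < n → κ a D.δ = 0 := by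
    intro n
    induction n with
    | zero => intro a _ _ _ h; omega
    | succ n ih =>
      intro a ha haP har hn
      by_cases hsum : ∃ b, (IsRootOf D.h b ∧ b ∈ D.P) ∧ ∃ c, (IsRootOf D.h c ∧ c ∈ D.P) ∧ a = b + c
      · have hdec : ∀ b c, IsRootOf D.h b → b ∈ D.P → IsRootOf D.h c → c ∈ D.P → a = b + c →
            κ b D.δ = 0 := by
          intro b c hb hbP hc hcP habc
          -- Two non-negative restrictions with sum zero both vanish, so the summands stay in Δ₀.
          have hb0 : restr D.θ b = 0 := by
            refine D.Q_antisymm _ (D.restr_mem_Q b hb hbP) ?_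
            rw [habc, restr_add] at har
            rw [neg_eq_of_add_eq_zero_right har]
            exact D.restr_mem_Q c hc hcP
          refine ih b hb hbP hb0 (lt_of_lt_of_le (Set.ncard_lt_ncard ?_ ?_) (Nat.lt_succ_iff.1 hn))
          · refine ⟨fun d hd => ⟨hd.1, hd.2.1, ?_⟩, fun hsub => ?_⟩
            · have : a - d = (b - d) + c := by rw [habc]; abel
              rw [this]
              exact D.P_add _ hd.2.2 _ hcP
            · have h0 : (0 : L) ∈ D.P := by
                have := D.δ_highest _ D.δ_root
                rwa [sub_self] at this
              have := (hsub ⟨ha, haP, by rwa [sub_self]⟩).2.2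
              rw [habc, sub_add_cancel_left] at this
              exact hc.2.1 (D.P_antisymm _ hcP this)
          · exact D.finite_roots.subset fun d hd => hd.1
        obtain ⟨b, ⟨hb, hbP⟩, c, ⟨hc, hcP⟩, habc⟩ := hsum
        rw [habc, map_add, LinearMap.add_apply, hdec b c hb hbP hc hcP habc,
          hdec c b hc hcP hb hbP (by rw [habc, add_comm]), add_zero]
      · exact hs a ha haP hsum har
  rcases D.P_total a ha with h | h
  · exact key _ a ha h har (Nat.lt_succ_self _)
  · have := key _ (-a) (D.root_neg ha) h (by rw [restr_neg, har, neg_zero]) (Nat.lt_succ_self _)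
    rwa [map_neg, LinearMap.neg_apply, neg_eq_zero] at this

/-- The vectors e and θf share the restricted root δ̄, so in a one-dimensional space they are
proportional and have equal 𝔥-weights. -/
theorem θ_δ_of_finrank [Module.Finite ℂ L]
    (h : Module.finrank ℂ (weightSpace D.hp (restr D.θ D.δ)) = 1) : D.θ D.δ = -D.δ := by
  obtain ⟨e, f, he0, hf0, he, hf, -⟩ := D.exists_sl2 D.δ_root
  have hθf := D.θ_mem_weightSpace D.θ_mem hf
  rw [map_neg] at hθf
  have h1 := D.mem_restr he
  have h2 := D.mem_restr hθf
  rw [D.restr_neg_θ] at h2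
  have h3 := (finrank_eq_one_iff_of_nonzero' (⟨e, h1⟩ : weightSpace D.hp (restr D.θ D.δ))
    (fun h => he0 (congrArg Subtype.val h))).1 h ⟨D.θ f, h2⟩
  obtain ⟨c, hc⟩ := h3
  have hc : c • e = D.θ f := congrArg Subtype.val hc
  have hθf0 : D.θ f ≠ 0 := fun h => hf0 (by rw [← D.θ_θ f, h, map_zero])
  have := D.weight_unique D.δ_root.1 D.root_ε.1 hθf0 (hc ▸ Submodule.smul_mem _ c he) hθf
  rw [this, map_neg, D.θ_θ]
  rw [← this]

/-! ### Generating 𝔤 from the highest root vector. -/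

section HighestWeight

/-- The subspace generated from `e` by repeated application of root vectors whose restricted root is
negative. -/
inductive Lowered (e : L) : L → Prop
  | base : Lowered e e
  | lie {a x y : L} (ha : IsRootOf D.h a) (hneg : -restr D.θ a ∈ D.Q) (hne : restr D.θ a ≠ 0)
      (hx : x ∈ weightSpace D.h a) (hy : Lowered e y) : Lowered e ⁅x, y⁆

/-- The restricted root space of `-δ̄` is the lowest one. -/
theorem lie_eq_zero_of_lowest [Module.Finite ℂ L] {a x y : L} (ha : IsRootOf D.h a)
    (hneg : -restr D.θ a ∈ D.Q) (hne : restr D.θ a ≠ 0) (hx : x ∈ weightSpace D.h a)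
    (hy : y ∈ weightSpace D.hp (-restr D.θ D.δ)) : ⁅x, y⁆ = 0 := by
  have hxy := lie_mem_weightSpace (D.mem_restr hx) hy
  refine D.eq_zero_of_kf fun b hb z hz => ?_
  by_contra h0
  by_cases hz0 : z = 0
  · rw [hz0, map_zero] at h0; exact h0 rfl
  have h1 := D.nondeg_hp _ (add_mem (add_mem (D.restr_mem ha.1) (neg_mem (D.restr_mem D.δ_root.1)))
    (D.restr_mem hb)) (kf_add_eq_zero hxy (D.mem_restr hz) h0)
  -- A non-zero pairing would give ā = δ̄ − b̄ ≥ 0, against ā < 0.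
  have h2 : restr D.θ a = restr D.θ D.δ - restr D.θ b := by
    rw [← sub_eq_zero, ← h1]; abel
  apply hne
  rcases D.root_or_zero hb hz0 hz with h | h
  · refine D.Q_antisymm _ ?_ hneg
    rw [h2]
    exact D.restr_le b h
  · refine D.Q_antisymm _ ?_ hneg
    rw [h2, h]
    simpa [restr] using D.restr_δ_mem_Q

theorem finrank_restr_δ [Module.Finite ℂ L]
    (hperp : ∀ a, IsRootOf D.h a → restr D.θ a = 0 → κ a D.δ = 0) :
    Module.finrank ℂ (weightSpace D.hp (restr D.θ D.δ)) = 1 := by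
  obtain ⟨e, f, he0, hf0, he, hf, t⟩ := D.exists_sl2 D.δ_root
  set A : Submodule ℂ L := Submodule.span ℂ {x | D.Lowered e x} with hA
  have hlow : ∀ a, IsRootOf D.h a → -restr D.θ a ∈ D.Q → restr D.θ a ≠ 0 →
      ∀ x ∈ weightSpace D.h a, ∀ y ∈ A, ⁅x, y⁆ ∈ A := by
    intro a ha hneg hne x hx y hy
    induction hy using Submodule.span_induction with
    | mem y hy => exact Submodule.subset_span (Lowered.lie ha hneg hne hx hy)
    | zero => rw [lie_zero]; exact zero_mem _
    | add y z _ _ hy hz => rw [lie_add]; exact add_mem hy hz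
    | smul c y _ hy => rw [lie_smul]; exact Submodule.smul_mem _ _ hy
  have heA : e ∈ A := Submodule.subset_span Lowered.base
  -- The span is an ideal once it contains all [e,z]. Only z with root in Δ₀ needs orthogonality;
  -- other positive roots kill e, other negative ones lower it, and 𝔥 scales it.
  have hbase : ∀ z : L, ⁅e, z⁆ ∈ A := by
    refine D.weightSpaces_span (A.comap (LieAlgebra.ad ℂ L e)) fun a ha x hx => ?_
    rw [Submodule.mem_comap, LieAlgebra.ad_apply]
    by_cases hx0 : x = 0
    · rw [hx0, lie_zero]; exact zero_mem _
    have hP : ∀ {a x}, IsRootOf D.h a → a ∈ D.P → x ∈ weightSpace D.h a → ⁅e, x⁆ = 0 :=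
      fun ha haP hx => D.weightSpace_δ_add ha haP (lie_mem_weightSpace he hx)
    rcases D.root_or_zero ha hx0 hx with hroot | rfl
    · by_cases har : restr D.θ a = 0
      · have h0 : ⁅e, x⁆ = 0 := by
          rcases D.P_total a hroot with haP | haP
          · exact hP hroot haP hx
          -- Here −δ + a is not a weight, so f kills x, and x has weight 0 for the triple of δ.
          · refine D.lie_eq_zero_of_weight_zero t D.δ_root.1 hx ?_
              (D.weightSpace_neg_δ_add hroot haP (lie_mem_weightSpace hf hx))
            rw [kf_comm]
            exact hperp a hroot har
        rw [h0]; exact zero_mem _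
      · rcases D.P_total a hroot with haP | haP
        · rw [hP hroot haP hx]; exact zero_mem _
        · rw [← lie_skew]
          refine neg_mem (hlow a hroot ?_ har x hx e heA)
          rw [← restr_neg]
          exact D.restr_mem_Q _ (D.root_neg hroot) haP
    · rw [← lie_skew, he x (D.mem_weightSpace_zero.1 hx)]
      exact neg_mem (Submodule.smul_mem _ _ heA)
  have hlie : ∀ w, D.Lowered e w → ∀ z : L, ⁅z, w⁆ ∈ A := by
    intro w hw
    induction hw with
    | base => intro z; rw [← lie_skew]; exact neg_mem (hbase z)
    | lie ha hneg hne hx _ ih =>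
      intro z
      rw [leibniz_lie]
      exact add_mem (ih _) (hlow _ ha hneg hne _ hx _ (ih z))
  let I : LieIdeal ℂ L :=
    { A with
      lie_mem := fun {z w} hw => by
        change w ∈ A at hw
        change ⁅z, w⁆ ∈ A
        induction hw using Submodule.span_induction with
        | mem w hw => exact hlie w hw z
        | zero => rw [lie_zero]; exact zero_mem _
        | add w w' _ _ hw hw' => rw [lie_add]; exact add_mem hw hw'
        | smul c w _ hw => rw [lie_smul]; exact Submodule.smul_mem _ _ hw }
  have hmemA : ∀ x, x ∈ A := by
    have hI : I = ⊤ := by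
      refine D.ideal_eq_top I fun hI => he0 ?_
      have : e ∈ I := heA
      rwa [hI, LieSubmodule.mem_bot] at this
    intro x
    have : x ∈ I := by rw [hI]; trivial
    exact this
  -- Every spanning vector other than e is a bracket [x,w] with x lowering, and κ([x,w],y) =
  -- −κ(w,[x,y]) = 0.
  have hzero : ∀ y ∈ weightSpace D.hp (-restr D.θ D.δ), κ e y = 0 → y = 0 := by
    intro y hy hey
    apply D.nondeg
    intro w
    have hw := hmemA w
    rw [kf_comm]
    induction hw using Submodule.span_induction with
    | mem w hw =>
      cases hw with
      | base => exact hey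
      | lie ha hneg hne hx hw =>
        rw [← lie_skew, map_neg, LinearMap.neg_apply, kf_lie,
          D.lie_eq_zero_of_lowest ha hneg hne hx hy, map_zero, neg_zero]
    | zero => rw [map_zero, LinearMap.zero_apply]
    | add w w' _ _ hw hw' => rw [map_add, LinearMap.add_apply, hw, hw', add_zero]
    | smul c w _ hw => rw [map_smul, LinearMap.smul_apply, hw, smul_zero]
  have hf' := D.mem_restr hf
  rw [restr_neg] at hf'
  have hef : κ e f ≠ 0 := fun h => hf0 (hzero f hf' h)
  have hθδ : D.θ (restr D.θ D.δ) = -restr D.θ D.δ := D.θ_hp _ (D.restr_mem D.δ_root.1)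
  have hθf := D.θ_mem_weightSpace (fun _ => D.θ_mem_hp) hf'
  rw [map_neg, hθδ, neg_neg] at hθf
  refine (finrank_eq_one_iff_of_nonzero'
    (⟨D.θ f, hθf⟩ : weightSpace D.hp (restr D.θ D.δ)) fun h => hf0 ?_).2 fun ⟨x, hx⟩ => ?_
  · rw [← D.θ_θ f, show D.θ f = 0 from congrArg Subtype.val h, map_zero]
  · have hθx := D.θ_mem_weightSpace (fun _ => D.θ_mem_hp) hx
    rw [hθδ] at hθx
    refine ⟨κ e (D.θ x) / κ e f, Subtype.ext ?_⟩
    change (κ e (D.θ x) / κ e f) • D.θ f = x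
    have h0 := hzero (D.θ x - (κ e (D.θ x) / κ e f) • f)
      (sub_mem hθx (Submodule.smul_mem _ _ hf')) (by
        rw [map_sub, map_smul, smul_eq_mul, div_mul_cancel₀ _ hef, sub_self])
    rw [← map_smul, ← sub_eq_zero.1 h0, D.θ_θ]

end HighestWeight
end OrderedRootData
end Order

/-! ### Lexicographic orders as positive cones. -/

section Lex
variable {u : Type*} [LieRing u] [LieAlgebra ℝ u] {V : Submodule ℝ (Complexified u)} {n : ℕ}
  (b : Module.Basis (Fin n) ℝ V)

theorem lexLE_iff {x y : Complexified u} (hx : x ∈ V) (hy : y ∈ V) :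
    lexLE b x y ↔ toLex (b.equivFun ⟨x, hx⟩) ≤ toLex (b.equivFun ⟨y, hy⟩) :=
  ⟨fun ⟨_, _, h⟩ => h, fun h => ⟨hx, hy, h⟩⟩

theorem lexLE_zero_iff {x : Complexified u} (hx : x ∈ V) :
    lexLE b 0 x ↔ 0 ≤ toLex (b.equivFun ⟨x, hx⟩) := by
  rw [lexLE_iff b V.zero_mem hx]
  have : b.equivFun ⟨0, V.zero_mem⟩ = 0 := map_zero b.equivFun
  rw [this]; rfl

theorem toLex_equivFun_neg {x : Complexified u} (hx : x ∈ V) :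
    toLex (b.equivFun ⟨-x, V.neg_mem hx⟩) = -toLex (b.equivFun ⟨x, hx⟩) := by
  rw [← toLex_neg, ← map_neg]; rfl

theorem lexLE_zero_sub {x y : Complexified u} (h : lexLE b x y) : lexLE b 0 (y - x) := by
  obtain ⟨hx, hy, h⟩ := h
  rw [lexLE_zero_iff b (V.sub_mem hy hx)]
  have : toLex (b.equivFun ⟨y - x, V.sub_mem hy hx⟩) =
      toLex (b.equivFun ⟨y, hy⟩) - toLex (b.equivFun ⟨x, hx⟩) := by
    rw [← toLex_sub, ← map_sub]; rfl
  rw [this]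
  exact sub_nonneg.2 h

theorem lexLE_zero_add {x y : Complexified u} (hx : lexLE b 0 x) (hy : lexLE b 0 y) :
    lexLE b 0 (x + y) := by
  have hxV := hx.2.1
  have hyV := hy.2.1
  rw [lexLE_zero_iff b hxV] at hx
  rw [lexLE_zero_iff b hyV] at hy
  rw [lexLE_zero_iff b (V.add_mem hxV hyV)]
  have : toLex (b.equivFun ⟨x + y, V.add_mem hxV hyV⟩) =
      toLex (b.equivFun ⟨x, hxV⟩) + toLex (b.equivFun ⟨y, hyV⟩) := by
    rw [← toLex_add, ← map_add]; rfl
  rw [this]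
  exact add_nonneg hx hy

theorem lexLE_zero_antisymm {x : Complexified u} (hx : lexLE b 0 x) (hx' : lexLE b 0 (-x)) :
    x = 0 := by
  have hxV := hx.2.1
  rw [lexLE_zero_iff b hxV] at hx
  rw [lexLE_zero_iff b (V.neg_mem hxV), toLex_equivFun_neg b hxV, Left.nonneg_neg_iff] at hx'
  have h : b.equivFun ⟨x, hxV⟩ = 0 := toLex.injective (le_antisymm hx' hx)
  rw [LinearEquiv.map_eq_zero_iff] at h
  exact congrArg Subtype.val h

theorem lexLE_zero_total {x : Complexified u} (hx : x ∈ V) : lexLE b 0 x ∨ lexLE b 0 (-x) := by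
  rw [lexLE_zero_iff b hx, lexLE_zero_iff b (V.neg_mem hx), toLex_equivFun_neg b hx,
    Left.nonneg_neg_iff]
  exact le_total _ _

/-- Compatibility compares roots only with roots, and 0 is not one. This expresses positivity of α
as −α ≤ α. -/
theorem lexLE_neg_self {x : Complexified u} : lexLE b (-x) x ↔ lexLE b 0 x := by
  constructor
  · intro h
    have hx := h.2.1
    rw [lexLE_iff b (V.neg_mem hx) hx, toLex_equivFun_neg b hx] at h
    rw [lexLE_zero_iff b hx]
    exact neg_le_self_iff.1 h
  · intro h
    have hx := h.2.1
    rw [lexLE_zero_iff b hx] at h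
    rw [lexLE_iff b (V.neg_mem hx) hx, toLex_equivFun_neg b hx]
    exact neg_le_self_iff.2 h

end Lex

/-! ### The complexified involution as an automorphism. -/

section Theta
variable {u : Type*} [LieRing u] [LieAlgebra ℝ u]

@[simp] theorem thetaC_tmul (θ : u ≃ₗ⁅ℝ⁆ u) (z : ℂ) (a : u) :
    thetaC θ (z ⊗ₜ[ℝ] a) = z ⊗ₜ[ℝ] θ a := rfl

theorem thetaC_eq (θ : u ≃ₗ⁅ℝ⁆ u) (x : Complexified u) :
    thetaC θ x = (1 : ℂ) ⊗ₜ[ℝ] θ (rePart x) + Complex.I ⊗ₜ[ℝ] θ (imPart x) := by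
  conv_lhs => rw [← re_add_im x]
  rw [map_add, thetaC_tmul, thetaC_tmul]

theorem rePart_thetaC (θ : u ≃ₗ⁅ℝ⁆ u) (x : Complexified u) :
    rePart (thetaC θ x) = θ (rePart x) := by
  rw [thetaC_eq, map_add]; simp

theorem imPart_thetaC (θ : u ≃ₗ⁅ℝ⁆ u) (x : Complexified u) :
    imPart (thetaC θ x) = θ (imPart x) := by
  rw [thetaC_eq, map_add]; simp

theorem thetaC_lie (θ : u ≃ₗ⁅ℝ⁆ u) (x y : Complexified u) :
    thetaC θ ⁅x, y⁆ = ⁅thetaC θ x, thetaC θ y⁆ := by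
  induction x using TensorProduct.induction_on with
  | zero =>
    have h : ∀ y : Complexified u, ⁅(0 : Complexified u), y⁆ = 0 := fun y =>
      zero_lie (L := Complexified u) (M := Complexified u) y
    rw [h, map_zero, h]
  | add x x' hx hx' =>
    have h : ∀ x x' y : Complexified u, ⁅x + x', y⁆ = ⁅x, y⁆ + ⁅x', y⁆ := fun x x' y =>
      add_lie (L := Complexified u) (M := Complexified u) x x' y
    rw [h, map_add, hx, hx', map_add, h]
  | tmul z a =>
    induction y using TensorProduct.induction_on with
    | zero =>
      have h : ∀ y : Complexified u, ⁅y, (0 : Complexified u)⁆ = 0 := fun y =>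
        lie_zero (L := Complexified u) (M := Complexified u) y
      rw [h, map_zero, h]
    | add x x' hx hx' =>
      have h : ∀ y x x' : Complexified u, ⁅y, x + x'⁆ = ⁅y, x⁆ + ⁅y, x'⁆ := fun y x x' =>
        lie_add (L := Complexified u) (M := Complexified u) y x x'
      rw [h, map_add, hx, hx', map_add, h]
    | tmul w c => simp [LieAlgebra.ExtendScalars.bracket_tmul, LieEquiv.map_lie]

theorem thetaC_thetaC {θ : u ≃ₗ⁅ℝ⁆ u} (hθ : ∀ x, θ (θ x) = x) (x : Complexified u) :
    thetaC θ (thetaC θ x) = x :=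
  ext_re_im (by rw [rePart_thetaC, rePart_thetaC, hθ]) (by rw [imPart_thetaC, imPart_thetaC, hθ])

/-- The complex linear extension of an involution as an automorphism of the complexification. -/
noncomputable def thetaEquiv {θ : u ≃ₗ⁅ℝ⁆ u} (hθ : ∀ x, θ (θ x) = x) :
    Complexified u ≃ₗ⁅ℂ⁆ Complexified u :=
  { thetaC θ with
    map_lie' := fun {x y} => thetaC_lie θ x y
    invFun := thetaC θ
    left_inv := thetaC_thetaC hθ
    right_inv := thetaC_thetaC hθ }

end Theta

theorem lie_add_smul_eq_zero {L : Type*} [LieRing L] [LieAlgebra ℂ L] {a b y : L}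
    (z : ℂ) (ha : ⁅a, y⁆ = 0) (hb : ⁅b, y⁆ = 0) :
    ⁅a + z • b, y⁆ = 0 := by
  rw [add_lie, smul_lie, ha, hb, smul_zero, add_zero]

/-! ### Root space decomposition and finiteness of the root system. -/

section Abstract
variable {L : Type*} [LieRing L] [LieAlgebra ℂ L] [Module.Finite ℂ L]

open LieAlgebra IsKilling in
/-- The root space decomposition. -/
theorem weightSpaces_span_of_isCartan [LieAlgebra.IsKilling ℂ L] (H : LieSubalgebra ℂ L)
    [H.IsCartanSubalgebra] (p : Submodule ℂ L)
    (hp : ∀ a ∈ H.toSubmodule, weightSpace H.toSubmodule a ≤ p) (x : L) : x ∈ p := by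
  have htop := LieModule.iSup_genWeightSpace_eq_top' ℂ H L
  have hle : ∀ χ : LieModule.Weight ℂ H L, (LieModule.genWeightSpace L χ).toSubmodule ≤ p := by
    intro χ y hy
    let a : H := (cartanEquivDual H).symm (χ.toLinear ℂ H L)
    have ha : ∀ h : H, killingForm ℂ L h a = χ h := fun h => by
      have h1 : cartanEquivDual H a = χ.toLinear ℂ H L := LinearEquiv.apply_symm_apply _ _
      have h2 := congrArg (fun f => f h) h1
      rw [kf_comm]
      exact h2
    refine hp a a.2 fun h hh => ?_
    -- With non-degenerate Killing form, generalised root spaces are genuine eigenspaces.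
    have h1 := lie_eq_smul_of_mem_rootSpace hy ⟨h, hh⟩
    rw [← ha] at h1
    exact h1
  have hx : x ∈ (⨆ χ : LieModule.Weight ℂ H L, LieModule.genWeightSpace L χ).toSubmodule := by
    rw [htop]; trivial
  rw [LieSubmodule.iSup_toSubmodule] at hx
  exact iSup_le hle hx

theorem finite_isRootOf (H : LieSubalgebra ℂ L) [LieRing.IsNilpotent H]
    (hH : ∀ x ∈ H.toSubmodule, (∀ y ∈ H.toSubmodule, killingForm ℂ L x y = 0) → x = 0) :
    {a | IsRootOf H.toSubmodule a}.Finite := by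
  refine Set.Finite.of_injOn (f := fun a => fun h : H => killingForm ℂ L h a) ?_ ?_
    (LieModule.finite_genWeightSpace_ne_bot ℂ H L)
  · rintro a ⟨-, -, x, hx0, hx⟩ hbot
    have : x ∈ LieModule.weightSpace L (fun h : H => killingForm ℂ L h a) := by
      rw [LieModule.mem_weightSpace]
      exact fun h => hx h h.2
    have := LieModule.weightSpace_le_genWeightSpace L _ this
    rw [hbot] at this
    exact hx0 this
  · intro a ha b hb hab
    rw [← sub_eq_zero]
    refine hH _ (sub_mem ha.1 hb.1) fun y hy => ?_
    have : killingForm ℂ L y a = killingForm ℂ L y b := congrFun hab ⟨y, hy⟩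
    rw [kf_comm, map_sub, this, sub_self]

end Abstract

/-! ### Cartan subalgebras from maximal abelian subalgebras. -/

section Cartan
variable {u : Type*} [LieRing u] [LieAlgebra ℝ u]

theorem one_tmul_lie_eq_zero_iff {w : u} {x : Complexified u} :
    ⁅(1 : ℂ) ⊗ₜ[ℝ] w, x⁆ = 0 ↔ ⁅w, rePart x⁆ = 0 ∧ ⁅w, imPart x⁆ = 0 := by
  rw [← rePart_lie, ← imPart_lie]
  refine ⟨fun h => by rw [h, map_zero, map_zero]; exact ⟨rfl, rfl⟩, fun h => ext_re_im ?_ ?_⟩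
  · rw [h.1, map_zero]
  · rw [h.2, map_zero]

theorem lie_eq_zero_of_one_tmul_lie {W : Submodule ℝ u} {x y : Complexified u}
    (hx : x ∈ W.baseChange ℂ) (hy : ∀ w ∈ W, ⁅(1 : ℂ) ⊗ₜ[ℝ] w, y⁆ = 0) : ⁅x, y⁆ = 0 := by
  rw [mem_baseChange_iff] at hx
  have h1 : (1 : ℂ) ⊗ₜ[ℝ] rePart x + Complex.I • ((1 : ℂ) ⊗ₜ[ℝ] imPart x) = x := by
    conv_rhs => rw [← re_add_im x]
    rw [TensorProduct.smul_tmul', smul_eq_mul, mul_one]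
  rw [← h1]
  exact lie_add_smul_eq_zero (L := Complexified u) _ (hy _ hx.1) (hy _ hx.2)

theorem lie_baseChange_eq_zero {W : Submodule ℝ u} (hW : IsAbelianSubspace W)
    {x y : Complexified u} (hx : x ∈ W.baseChange ℂ) (hy : y ∈ W.baseChange ℂ) : ⁅x, y⁆ = 0 := by
  rw [mem_baseChange_iff] at hy
  exact lie_eq_zero_of_one_tmul_lie hx fun w hw =>
    one_tmul_lie_eq_zero_iff.2 ⟨hW w hw _ hy.1, hW w hw _ hy.2⟩

/-- The complexification of an abelian subspace, as a subalgebra. -/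
noncomputable def cartan {W : Submodule ℝ u} (hW : IsAbelianSubspace W) :
    LieSubalgebra ℂ (Complexified u) :=
  { W.baseChange ℂ with
    lie_mem' := fun {x y} hx hy => by
      have : (⁅x, y⁆ : Complexified u) = 0 := lie_baseChange_eq_zero hW hx hy
      change (⁅x, y⁆ : Complexified u) ∈ W.baseChange ℂ
      rw [this]
      exact zero_mem _ }

/-- The complexification of a maximal abelian subalgebra is a Cartan subalgebra. -/
theorem IsCompact.isCartanSubalgebra [Module.Finite ℝ u] (hu : IsCompact u) {W : Submodule ℝ u}
    (hW : Maximal (fun W : Submodule ℝ u => W ≤ ⊤ ∧ IsAbelianSubspace W) W) :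
    (cartan hW.1.2).IsCartanSubalgebra := by
  have hab : IsLieAbelian (cartan hW.1.2) :=
    ⟨fun x y => Subtype.ext (lie_baseChange_eq_zero hW.1.2 x.2 y.2)⟩
  refine ⟨inferInstance, le_antisymm (fun x hx => ?_) (LieSubalgebra.le_normalizer _)⟩
  rw [LieSubalgebra.mem_normalizer_iff'] at hx
  refine mem_baseChange_of_commute hW (by simp) fun w hw => ?_
  -- An element normalizing W ⊗ ℂ satisfies (ad w)²x = 0, so semisimplicity of ad w makes it
  -- centralize W.
  have h : ⁅(1 : ℂ) ⊗ₜ[ℝ] w, x⁆ ∈ W.baseChange ℂ := hx _ (one_tmul_mem hw)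
  rw [mem_baseChange_iff, rePart_lie, imPart_lie] at h
  exact one_tmul_lie_eq_zero_iff.2
    ⟨hu.lie_eq_zero_of_lie_lie_eq_zero (hW.1.2 w hw _ h.1),
      hu.lie_eq_zero_of_lie_lie_eq_zero (hW.1.2 w hw _ h.2)⟩

end Cartan

/-! ### The abstract data realised in the complexification. -/

section Instantiation
variable {u : Type*} [LieRing u] [LieAlgebra ℝ u]

theorem IsCartanPair.theta_mem {θ : u ≃ₗ⁅ℝ⁆ u} {hk hp : Submodule ℝ u} (h : IsCartanPair θ hk hp)
    {w : u} (hw : w ∈ hk ⊔ hp) : θ w ∈ hk ⊔ hp := by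
  obtain ⟨a, ha, b, hb, rfl⟩ := Submodule.mem_sup.1 hw
  have h1 : θ a = a := h.hk_le ha
  have h2 : θ b = -b := h.hp_maximal.1.1 hb
  rw [map_add, h1, h2]
  exact add_mem (Submodule.mem_sup_left ha) (Submodule.mem_sup_right (neg_mem hb))

theorem IsCartanPair.maximal_le_top {θ : u ≃ₗ⁅ℝ⁆ u} {hk hp : Submodule ℝ u}
    (h : IsCartanPair θ hk hp) :
    Maximal (fun W : Submodule ℝ u => W ≤ ⊤ ∧ IsAbelianSubspace W) (hk ⊔ hp) :=
  ⟨⟨le_top, h.sup_maximal.1⟩, fun _ hW hle => h.sup_maximal.2 hW.2 hle⟩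

/-- A non-trivial involution has a non-trivial maximal abelian subspace in its `-1` eigenspace. -/
theorem OrthogonalInvolution.hp_ne_bot (σ : OrthogonalInvolution u) {hk hp : Submodule ℝ u}
    (h : IsCartanPair σ.θ hk hp) : hp ≠ ⊥ := by
  rintro rfl
  obtain ⟨x, hx⟩ := σ.ne_id
  -- A line in 𝔭_* is abelian, so maximality of 0 forces x = θx.
  have hle : Submodule.span ℝ {x - σ.θ x} ≤ ⊥ := by
    refine h.hp_maximal.2 ⟨?_, ?_⟩ bot_le
    · rw [Submodule.span_singleton_le_iff_mem]
      change σ.θ (x - σ.θ x) = -(x - σ.θ x)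
      rw [map_sub, σ.involutive, neg_sub]
    · intro y hy z hz
      obtain ⟨r, rfl⟩ := Submodule.mem_span_singleton.1 hy
      obtain ⟨s, rfl⟩ := Submodule.mem_span_singleton.1 hz
      rw [smul_lie, lie_smul, lie_self, smul_zero, smul_zero]
  rw [Submodule.span_singleton_le_iff_mem, Submodule.mem_bot, sub_eq_zero] at hle
  exact hx hle.symm

variable [Module.Finite ℝ u]

theorem IsCompact.form_self_ne_zero (hu : IsCompact u) {W : Submodule ℝ u} {x : Complexified u}
    (hx : x ∈ imag W) (hx0 : x ≠ 0) : form x x ≠ 0 := by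
  obtain ⟨w, -, rfl⟩ := hx
  have hw : w ≠ 0 := by
    rintro rfl
    exact hx0 (map_zero _)
  rw [TensorProduct.mk_apply, form_tmul, Complex.I_mul_I, neg_one_mul, neg_ne_zero,
    Complex.ofReal_ne_zero]
  exact (hu w hw).ne

/-- The Cartan data of the complexification of a compact simple Lie algebra with involution. -/
noncomputable def splitCartanData [LieAlgebra.IsSimple ℝ u] (hu : IsCompact u)
    (σ : OrthogonalInvolution u) {hk hp : Submodule ℝ u} (hc : IsCartanPair σ.θ hk hp)
    (himag : ∀ a ∈ roots (hk ⊔ hp), a ∈ imag (hk ⊔ hp)) : SplitCartanData (Complexified u) where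
  h := (hk ⊔ hp).baseChange ℂ
  hp := hp.baseChange ℂ
  θ := thetaEquiv σ.involutive
  hp_le := fun x hx => by
    rw [mem_baseChange_iff] at hx ⊢
    exact ⟨Submodule.mem_sup_right hx.1, Submodule.mem_sup_right hx.2⟩
  hp_ne_bot := fun h => by
    obtain ⟨w, hw, hw0⟩ := Submodule.exists_mem_ne_zero_of_ne_bot (σ.hp_ne_bot hc)
    have h1 := one_tmul_mem hw
    rw [h, Submodule.mem_bot] at h1
    apply hw0
    have h2 := congrArg rePart h1
    rwa [rePart_tmul, Complex.one_re, one_smul, map_zero] at h2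
  θ_θ := thetaC_thetaC σ.involutive
  θ_mem := fun x hx => by
    rw [mem_baseChange_iff] at hx
    change thetaC σ.θ x ∈ _
    rw [mem_baseChange_iff, rePart_thetaC, imPart_thetaC]
    exact ⟨hc.theta_mem hx.1, hc.theta_mem hx.2⟩
  θ_hp := fun x hx => by
    rw [mem_baseChange_iff] at hx
    change thetaC σ.θ x = -x
    have h1 : σ.θ (rePart x) = -rePart x := hc.hp_maximal.1.1 hx.1
    have h2 : σ.θ (imPart x) = -imPart x := hc.hp_maximal.1.1 hx.2
    exact ext_re_im (by rw [rePart_thetaC, h1, map_neg]) (by rw [imPart_thetaC, h2, map_neg])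
  lie_eq_zero := fun x hx y hy => lie_baseChange_eq_zero hc.sup_maximal.1 hx hy
  mem_h := fun x hx =>
    mem_baseChange_of_commute hc.maximal_le_top (by simp) fun w hw => hx _ (one_tmul_mem hw)
  mem_hp := fun x hθ hx => by
    refine mem_baseChange_of_commute hc.hp_maximal ?_ fun w hw => hx _ (one_tmul_mem hw)
    change thetaC σ.θ x = -x at hθ
    rw [mem_baseChange_iff]
    constructor
    · change σ.θ (rePart x) = -rePart x
      rw [← rePart_thetaC, hθ, map_neg]
    · change σ.θ (imPart x) = -imPart x
      rw [← imPart_thetaC, hθ, map_neg]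
  nondeg := fun x hx => hu.form_nondegenerate (W := ⊤) (by simp) fun y _ => hx y
  nondeg_h := fun x hx h => hu.form_nondegenerate hx h
  nondeg_hp := fun x hx h => hu.form_nondegenerate hx h
  weightSpaces_span := fun p hp x => by
    have := hu.isKilling
    have := hu.isCartanSubalgebra hc.maximal_le_top
    exact weightSpaces_span_of_isCartan (cartan hc.sup_maximal.1) p hp x
  ideal_eq_top := hu.lieIdeal_eq_top
  finite_roots := by
    have := hu.isCartanSubalgebra hc.maximal_le_top
    exact finite_isRootOf (cartan hc.sup_maximal.1) fun x hx h => hu.form_nondegenerate hx h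
  root_sq_ne_zero := fun a ha => hu.form_self_ne_zero (himag a ha) ha.2.1

/-- The root data of the complexification, ordered lexicographically. -/
noncomputable def orderedRootData [LieAlgebra.IsSimple ℝ u] (hu : IsCompact u)
    (σ : OrthogonalInvolution u) {hk hp : Submodule ℝ u} (hc : IsCartanPair σ.θ hk hp)
    {n m : ℕ} (b : Module.Basis (Fin n) ℝ (imag (hk ⊔ hp))) (c : Module.Basis (Fin m) ℝ (imag hp))
    (hcompatible : Compatible σ.θ b c) {δ : Complexified u} (hδ : IsHighestRoot b δ) :
    OrderedRootData (Complexified u) where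
  -- `lexLE` includes membership in 𝔥_ℝ, so comparison with δ already places every root there.
  toSplitCartanData := splitCartanData hu σ hc fun a ha => (hδ.2 a ha).1
  P := {x | lexLE b 0 x}
  Q := {x | lexLE c 0 x}
  δ := δ
  P_add := fun _ hx _ hy => lexLE_zero_add b hx hy
  P_antisymm := fun _ hx hx' => lexLE_zero_antisymm b hx hx'
  P_total := fun a ha => lexLE_zero_total b (hδ.2 a ha).1
  Q_antisymm := fun _ hx hx' => lexLE_zero_antisymm c hx hx'
  Q_add := fun _ hx _ hy => lexLE_zero_add c hx hy
  δ_root := hδ.1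
  δ_highest := fun a ha => lexLE_zero_sub b (hδ.2 a ha)
  restr_mem_Q := fun a ha haP => by
    have h1 := SplitCartanData.root_neg (splitCartanData hu σ hc fun a ha => (hδ.2 a ha).1) ha
    have h2 : lexLE c (restr (thetaEquiv σ.involutive) (-a))
        (restr (thetaEquiv σ.involutive) a) :=
      hcompatible a ha (-a) h1 ((lexLE_neg_self b).2 haP)
    rw [restr_neg] at h2
    exact (lexLE_neg_self c).1 h2
  restr_le := fun a ha => lexLE_zero_sub c (hcompatible δ hδ.1 a ha (hδ.2 a ha))

end Instantiation

end SymmetricLie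

/-! ### The equivalences. -/

theorem lemma3p2 {u : Type*} [LieRing u] [LieAlgebra ℝ u] [Module.Finite ℝ u]
    [LieAlgebra.IsSimple ℝ u] (hcompact : SymmetricLie.IsCompact u)
    (σ : SymmetricLie.OrthogonalInvolution u)
    (hk hp : Submodule ℝ u) (hcartan : SymmetricLie.IsCartanPair σ.θ hk hp)
    {n m : ℕ}
    (b : Module.Basis (Fin n) ℝ (SymmetricLie.imag (hk ⊔ hp)))
    (c : Module.Basis (Fin m) ℝ (SymmetricLie.imag hp))
    (hcompatible : SymmetricLie.Compatible σ.θ b c)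
    (δ : SymmetricLie.Complexified u) (hδ : SymmetricLie.IsHighestRoot b δ) :
    (SymmetricLie.form (SymmetricLie.bar σ.θ δ) (SymmetricLie.bar σ.θ δ)
          = SymmetricLie.form δ δ ∨
      SymmetricLie.form (SymmetricLie.bar σ.θ δ) (SymmetricLie.bar σ.θ δ)
          = (1 / 2 : ℂ) * SymmetricLie.form δ δ) ∧
    List.TFAE [
      SymmetricLie.form (SymmetricLie.bar σ.θ δ) (SymmetricLie.bar σ.θ δ)
          = SymmetricLie.form δ δ,
      SymmetricLie.thetaC σ.θ δ = -δ,
      SymmetricLie.simpleRoots b ∩ SymmetricLie.rootsZero σ.θ (hk ⊔ hp)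
          ⊆ SymmetricLie.simpleRoots b ∩ SymmetricLie.perp (hk ⊔ hp) δ,
      SymmetricLie.multiplicity hp (SymmetricLie.bar σ.θ δ) = 1] := by
  let D := SymmetricLie.orderedRootData hcompact σ hcartan b c hcompatible hδ
  constructor
  · by_cases h : D.θ D.δ = -D.δ
    · exact Or.inl (D.kf_restr_δ_of_eq h)
    · exact Or.inr (D.kf_restr_δ_of_ne h)
  · tfae_have 1 ↔ 2 := D.kf_restr_δ_iff
    tfae_have 2 → 3 := fun h a ha =>
      ⟨ha.1, ha.1.1.2.2.1, D.kf_eq_zero_of_θ_δ h ha.2.2⟩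
    tfae_have 3 → 4 := fun h =>
      D.finrank_restr_δ fun a ha har => D.kf_eq_zero_of_simple
        (fun a ha haP hs har => (h ⟨⟨⟨ha, haP⟩, hs⟩, ha, har⟩).2.2) ha har
    tfae_have 4 → 2 := D.θ_δ_of_finrank
    tfae_finish
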